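/- A \emph{dominating set reconfiguration instance} $\mathcal A=(G,D_{\mathsf{init}},D_{\mathsf{fin}},k)$ consists of a finite simple graph $G$ and two dominating sets $D_{\mathsf{init}},D_{\mathsf{fin}}$ of $G$ of size $k$ (the number of tokens). A reconfiguration sequence with $\ell$ moves is a sequence $D_{\mathsf{init}}=D_0,D_1,\dots,D_\ell=D_{\mathsf{fin}}$ of dominating sets of $G$ such that each $D_{i+1}$ arises from $D_i$ by moving one token from a vertex $u\in D_i$ to a vertex $v\notin D_i$; under Token Jumping (TJ) $v$ is arbitrary, under Token Sliding (TS) $uv$ must be an edge of $G$. In TJ- and TS-Dominating Set Reconfiguration, parameterized by $k$, one asks whether a reconfiguration sequence exists under the respective rule; instances are encoded as bit strings by writing $n=|V(G)|$ and $k$ in unary, the adjacency matrix of $G$ and the characteristic vectors of $D_{\mathsf{init}}$ and $D_{\mathsf{fin}}$. A \emph{pl-reduction} between parameterized problems is a map $f$ of instances that preserves the yes/no answer, for which the parameter of $f(\mathcal A)$ is at most $g(\kappa)$, where $\kappa$ is the parameter of $\mathcal A$ and $g$ is a computable function, and which is computed by a deterministic machine with read-only input and write-only output using working space $O(h(\kappa)+\log|x|)$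 bits on the encoding $x$ of $\mathcal A$, for a computable function $h$. **Lemma.** There exists a pl-reduction $f$ from TJ-Dominating Set Reconfiguration to TS-Dominating Set Reconfiguration such that for every instance $\mathcal A$ of TJ-Dominating Set Reconfiguration with $k$ tokens and every $\ell\ge 0$, $\mathcal A$ admits a TJ-reconfiguration sequence with at most $\ell$ moves if and only if $f(\mathcal A)$ admits a TS-reconfiguration sequence with at most $\ell+k+1$ moves. More precisely, if $\mathcal A$ admits a TJ-reconfiguration sequence with exactly $\ell$ moves, then $f(\mathcal A)$ admits a TS-reconfiguration sequence with exactly $\ell+k+1$ moves; and if $f(\mathcal A)$ admits a TS-reconfiguration sequence with exactly $m$ moves, then $\mathcal A$ admits a TJ-reconfiguration sequence with exactly $\ell$ moves for some $\ell$ with $\ell+k+1\le m$. -/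

import Mathlib

/-! ### Dominating sets and token moves -/

/-- `D` is a dominating set of `G`: every vertex is in `D` or has a neighbour in `D`. -/
def IsDominatingSet {V : Type} (G : SimpleGraph V) (D : Finset V) : Prop :=
  ∀ v, v ∈ D ∨ ∃ u ∈ D, G.Adj u v

/-- The two rules by which a token may be moved. -/
inductive TokenRule where
  /-- Token Jumping: a token may be moved to any empty vertex. -/
  | jumping
  /-- Token Sliding: a token may be moved to an empty adjacent vertex. -/
  | sliding

/-- Whether the rule allows to move a token from the vertex `u` to the (empty) vertex `v`. -/
def TokenRule.Allows {V : Type} (G : SimpleGraph V) : TokenRule → V → V → Prop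
  | .jumping, _, _ => True
  | .sliding, u, v => G.Adj u v

/-- `D'` arises from `D` by moving exactly one token, from `u ∈ D` to an empty vertex `v ∉ D`. -/
def TokenMove {V : Type} [DecidableEq V] (rule : TokenRule) (G : SimpleGraph V)
    (D D' : Finset V) : Prop :=
  ∃ u ∈ D, ∃ v ∉ D, rule.Allows G u v ∧ D' = insert v (D.erase u)

/-- An instance `(G, D_init, D_fin, k)` of Dominating Set Reconfiguration: a finite graph with an
initial and a final dominating set, both of size `k`. -/
structure DSRInstance where
  /-- number of vertices -/
  n : ℕ
  G : SimpleGraph (Fin n)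
  init : Finset (Fin n)
  fin : Finset (Fin n)
  /-- number of tokens -/
  k : ℕ
  card_init : init.card = k
  card_fin : fin.card = k
  dom_init : IsDominatingSet G init
  dom_fin : IsDominatingSet G fin

/-- `A` admits a reconfiguration sequence `D_init = S 0, S 1, …, S ℓ = D_fin` with exactly `ℓ`
token moves, all of whose members are dominating sets. -/
def DSRInstance.HasSeq (rule : TokenRule) (A : DSRInstance) (ℓ : ℕ) : Prop :=
  ∃ S : ℕ → Finset (Fin A.n), S 0 = A.init ∧ S ℓ = A.fin ∧
    (∀ i ≤ ℓ, IsDominatingSet A.G (S i)) ∧ ∀ i < ℓ, TokenMove rule A.G (S i) (S (i + 1))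

/-- `A` admits a reconfiguration sequence with at most `ℓ` token moves. -/
def DSRInstance.HasSeqWithin (rule : TokenRule) (A : DSRInstance) (ℓ : ℕ) : Prop :=
  ∃ m ≤ ℓ, A.HasSeq rule m

open Classical in
/-- The encoding of an instance as a bit string: `1ⁿ 0 1ᵏ 0`, the adjacency matrix row by row, and
the characteristic vectors of the initial and of the final dominating set. -/
noncomputable def DSRInstance.encode (A : DSRInstance) : List Bool :=
  List.replicate A.n true ++ [false] ++ List.replicate A.k true ++ [false] ++
    ((List.finRange A.n).flatMap fun u => (List.finRange A.n).map fun v => decide (A.G.Adj u v)) ++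
    ((List.finRange A.n).map fun v => decide (v ∈ A.init)) ++
    ((List.finRange A.n).map fun v => decide (v ∈ A.fin))

/-! ### Space-bounded computation

The machine model is a register machine with finitely many registers, each holding a natural
number, with random access to a read-only input and with a write-only output. The space used is the
total number of bits in the registers; neither the input nor the output is charged. Each
instruction can be carried out by a Turing machine in space linear in the number of bits involved
(keep each register in binary on a work tape), and conversely the contents of finitely many work
tapes can be kept as numbers in registers, so up to constant factors, and for space at least
logarithmic in the input length, this is the space of a Turing machine with read-only input tape
and write-only output tape. -/

/-- Arithmetic operations. -/
inductive ArithOp where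
  | add | sub | mul | div | mod

/-- Subtraction is truncated, `a / 0 = 0` and `a % 0 = a`. -/
def ArithOp.eval : ArithOp → ℕ → ℕ → ℕ
  | .add, a, b => a + b
  | .sub, a, b => a - b
  | .mul, a, b => a * b
  | .div, a, b => a / b
  | .mod, a, b => a % b

/-- Instructions of a machine with registers `0, …, R - 1`. -/
inductive RegInstr (R : ℕ) where
  /-- `r := c` -/
  | const (r : Fin R) (c : ℕ)
  /-- `r := a ∘ b` -/
  | arith (o : ArithOp) (r a b : Fin R)
  /-- `r :=` the input bit at the position held by register `a`, and `2` beyond the input's end -/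
  | read (r a : Fin R)
  /-- append the bit `b` to the output -/
  | write (b : Bool)

/-- Programs: the tests ask whether a register is nonzero. -/
inductive RegProg (R : ℕ) where
  | skip
  | instr (i : RegInstr R)
  | seq (p q : RegProg R)
  /-- if register `r` is nonzero then `p` else `q` -/
  | branch (r : Fin R) (p q : RegProg R)
  /-- while register `r` is nonzero do `p` -/
  | loop (r : Fin R) (p : RegProg R)

/-- The contents of the registers, and the output written so far. -/
@[ext] structure RegConfig (R : ℕ) where
  reg : Fin R → ℕ
  out : List Bool

/-- At the start all registers are `0` and the output is empty. -/
def RegConfig.start (R : ℕ) : RegConfig R := ⟨fun _ => 0, []⟩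

/-- The total number of bits in the registers. -/
def RegConfig.space {R : ℕ} (c : RegConfig R) : ℕ := ∑ r, (c.reg r).size

/-- The input symbol at position `a`: the bit there, or the end marker `2`. -/
def inputSymbol (x : List Bool) (a : ℕ) : ℕ :=
  match x[a]? with
  | some true => 1
  | some false => 0
  | none => 2

/-- The effect of one instruction, on input `x`. -/
def RegInstr.step {R : ℕ} (x : List Bool) : RegInstr R → RegConfig R → RegConfig R
  | .const r v, c => { c with reg := Function.update c.reg r v }
  | .arith o r a b, c => { c with reg := Function.update c.reg r (o.eval (c.reg a) (c.reg b)) }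
  | .read r a, c => { c with reg := Function.update c.reg r (inputSymbol x (c.reg a)) }
  | .write b, c => { c with out := c.out ++ [b] }

/-- `Runs x s p c d`: on input `x`, the program `p`, started in the configuration `c`, halts in
the configuration `d`, and after every instruction on the way the space is at most `s`. -/
inductive RegProg.Runs {R : ℕ} (x : List Bool) (s : ℕ) :
    RegProg R → RegConfig R → RegConfig R → Prop
  | skip (c : RegConfig R) : Runs x s .skip c c
  | instr (i : RegInstr R) (c : RegConfig R) (h : (i.step x c).space ≤ s) :
      Runs x s (.instr i) c (i.step x c)
  | seq {p q : RegProg R} {c d e : RegConfig R} (hp : Runs x s p c d) (hq : Runs x s q d e) :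
      Runs x s (.seq p q) c e
  | branch_pos {r : Fin R} {p q : RegProg R} {c d : RegConfig R} (hr : c.reg r ≠ 0)
      (hp : Runs x s p c d) : Runs x s (.branch r p q) c d
  | branch_neg {r : Fin R} {p q : RegProg R} {c d : RegConfig R} (hr : c.reg r = 0)
      (hq : Runs x s q c d) : Runs x s (.branch r p q) c d
  | loop_done {r : Fin R} {p : RegProg R} {c : RegConfig R} (hr : c.reg r = 0) :
      Runs x s (.loop r p) c c
  | loop_step {r : Fin R} {p : RegProg R} {c d e : RegConfig R} (hr : c.reg r ≠ 0)
      (hp : Runs x s p c d) (hl : Runs x s (.loop r p) d e) : Runs x s (.loop r p) c e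

/-- On input `x` the program `p` halts with output `y`, using space at most `s`. -/
def RegProg.ComputesInSpace {R : ℕ} (p : RegProg R) (x y : List Bool) (s : ℕ) : Prop :=
  ∃ d : RegConfig R, p.Runs x s (RegConfig.start R) d ∧ d.out = y

/-! ### Parameterized problems and pl-reductions -/

/-- A parameterized decision problem. -/
structure ParamProblem where
  Inst : Type
  encode : Inst → List Bool
  param : Inst → ℕ
  yes : Inst → Prop

/-- `f` is a parameterized logspace reduction (pl-reduction) from `P` to `Q`: it preserves the
answer, the new parameter is bounded by a computable function of the old one, and `f` is computed
by a single machine in space `O(h(κ) + log |x|)`, for a computable function `h`, on inputs `x` with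
parameter `κ`. -/
structure IsPLReduction (P Q : ParamProblem) (f : P.Inst → Q.Inst) : Prop where
  yes_iff : ∀ A, P.yes A ↔ Q.yes (f A)
  param_le : ∃ g : ℕ → ℕ, Computable g ∧ ∀ A, Q.param (f A) ≤ g (P.param A)
  logspace : ∃ (R : ℕ) (p : RegProg R) (h : ℕ → ℕ) (c : ℕ), Computable h ∧
    ∀ A, p.ComputesInSpace (P.encode A) (Q.encode (f A))
      (c * (h (P.param A) + Nat.log 2 (P.encode A).length))

/-- Dominating Set Reconfiguration under the given rule, parameterized by the number of tokens:
is there a reconfiguration sequence from the initial to the final dominating set? -/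
noncomputable def DominatingSetReconfiguration (rule : TokenRule) : ParamProblem where
  Inst := DSRInstance
  encode := DSRInstance.encode
  param := DSRInstance.k
  yes A := ∃ ℓ, A.HasSeq rule ℓ

/-! In `slideGraph` a token may reach any empty vertex of the first copy in one slide, because this
copy is a clique. The second copy keeps the domination condition: tokens on `D` in the first copy
dominate it exactly when `D` dominates `G`. So every jump becomes one slide (`TokenReaches.slide`).
The `k + 1` disjoint extra edges only account for the additive term: their tokens start at the near
ends and must finish at the far ends, which takes at least one slide each and can be done in exactly
one (`TokenReaches.cross`).

Conversely, forget which copy a token lies in. The resulting vertex set may have fewer than `k`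
elements, since a vertex can carry tokens in both copies, so one follows a dominating set of size
`k` that contains it. A slide inside the copies adds at most one vertex to the projection, and this
can be answered by at most one jump (`exists_jump`). A slide along an extra edge needs no jump and
adds at most one far end. Hence jumps plus occupied far ends never exceed the number of slides
(`TokenReaches.of_slideGraph`). At the end the projection has `k` elements, so the set followed
equals it, and all `k + 1` far ends are occupied.

For the space bound, the machine reads `n` and `k` from their unary blocks and writes each output
block by a counting loop. Every output bit is an arithmetic expression in `n`, `k`, the position in
the block and some input bits. Expressions compile to programs with a fixed stack of auxiliary
registers (`RegExpr.compile_runs`), and their values are polynomially bounded (`RegExpr.eval_le`),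
so boundedly many registers of logarithmic size suffice (`toSliding_logspace`). -/

/-! ### Reconfiguration sequences as an inductive relation -/

/-- `D'` is reached from `D` by `ℓ` token moves through dominating sets. -/
inductive TokenReaches {V : Type} [DecidableEq V] (rule : TokenRule) (G : SimpleGraph V)
    (D : Finset V) : ℕ → Finset V → Prop
  | refl (h : IsDominatingSet G D) : TokenReaches rule G D 0 D
  | step {ℓ : ℕ} {D₁ D₂ : Finset V} (h : TokenReaches rule G D ℓ D₁)
      (hm : TokenMove rule G D₁ D₂) (hd : IsDominatingSet G D₂) : TokenReaches rule G D (ℓ + 1) D₂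

theorem IsDominatingSet.map {V W : Type} {G : SimpleGraph V} {G' : SimpleGraph W} {D : Finset V}
    (e : G ≃g G') (hD : IsDominatingSet G D) :
    IsDominatingSet G' (D.map e.toEquiv.toEmbedding) := by
  intro v
  rcases hD (e.symm v) with h | ⟨u, hu, huv⟩
  · exact Or.inl (Finset.mem_map.mpr ⟨_, h, e.apply_symm_apply v⟩)
  · refine Or.inr ⟨e u, Finset.mem_map_of_mem _ hu, ?_⟩
    have := e.map_adj_iff.mpr huv
    rwa [e.apply_symm_apply] at this

namespace TokenReaches

variable {V W : Type} [DecidableEq V] [DecidableEq W] {rule : TokenRule}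
  {G : SimpleGraph V} {G' : SimpleGraph W} {D D₁ D₂ : Finset V} {ℓ m : ℕ}

theorem trans (h₁ : TokenReaches rule G D ℓ D₁) (h₂ : TokenReaches rule G D₁ m D₂) :
    TokenReaches rule G D (ℓ + m) D₂ := by
  induction h₂ with
  | refl _ => exact h₁
  | step _ hm hd ih => exact ih.step hm hd

theorem exists_seq (h : TokenReaches rule G D ℓ D₁) :
    ∃ S : ℕ → Finset V, S 0 = D ∧ S ℓ = D₁ ∧
      (∀ i ≤ ℓ, IsDominatingSet G (S i)) ∧ ∀ i < ℓ, TokenMove rule G (S i) (S (i + 1)) := by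
  induction h with
  | refl h => exact ⟨fun _ => D, rfl, rfl, fun _ _ => h, by simp⟩
  | @step ℓ D₁ D₂ _ hm hd ih =>
    obtain ⟨S, h0, hl, hdom, hmove⟩ := ih
    refine ⟨fun i => if i ≤ ℓ then S i else D₂, by simp [h0], by simp, fun i _ => ?_,
      fun i hi => ?_⟩
    · dsimp only
      split_ifs with h
      · exact hdom i h
      · exact hd
    · rcases (Nat.lt_succ_iff.mp hi).lt_or_eq with h | rfl
      · simpa [h.le, Nat.succ_le_of_lt h] using hmove i h
      · simpa [hl] using hm

theorem of_seq {S : ℕ → Finset V} (hdom : ∀ i ≤ ℓ, IsDominatingSet G (S i))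
    (hmove : ∀ i < ℓ, TokenMove rule G (S i) (S (i + 1))) :
    TokenReaches rule G (S 0) ℓ (S ℓ) := by
  induction ℓ with
  | zero => exact refl (hdom 0 le_rfl)
  | succ ℓ ih =>
    exact (ih (fun i hi => hdom i (by omega)) (fun i hi => hmove i (by omega))).step
      (hmove ℓ (by omega)) (hdom _ le_rfl)

theorem map (e : G ≃g G') (h : TokenReaches rule G D ℓ D₁) :
    TokenReaches rule G' (D.map e.toEquiv.toEmbedding) ℓ (D₁.map e.toEquiv.toEmbedding) := by
  induction h with
  | refl h => exact refl (h.map e)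
  | step _ hm hd ih =>
    refine ih.step ?_ (hd.map e)
    obtain ⟨u, hu, v, hv, ha, rfl⟩ := hm
    refine ⟨e u, Finset.mem_map_of_mem _ hu, e v, fun h => hv ?_, ?_, ?_⟩
    · exact (Finset.mem_map' e.toEquiv.toEmbedding).mp h
    · cases rule
      · trivial
      · exact e.map_adj_iff.mpr ha
    · rw [Finset.map_insert, Finset.map_erase]
      rfl

end TokenReaches

theorem DSRInstance.hasSeq_iff (A : DSRInstance) (rule : TokenRule) (ℓ : ℕ) :
    A.HasSeq rule ℓ ↔ TokenReaches rule A.G A.init ℓ A.fin := by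
  constructor
  · rintro ⟨S, h0, hl, hdom, hmove⟩
    rw [← h0, ← hl]
    exact TokenReaches.of_seq hdom hmove
  · exact TokenReaches.exists_seq

/-! ### The sliding graph -/

/-- A clique on a first copy of the vertices, a second copy whose vertices are joined to their
closed neighbourhoods in the first copy, and a disjoint edge for every element of `ι`. -/
def slideGraph {V : Type} (G : SimpleGraph V) (ι : Type) : SimpleGraph (V ⊕ V ⊕ ι × Bool) where
  Adj
    | .inl u, .inl v => u ≠ v
    | .inl u, .inr (.inl v) => u = v ∨ G.Adj u v
    | .inr (.inl u), .inl v => u = v ∨ G.Adj u v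
    | .inr (.inr p), .inr (.inr q) => p.1 = q.1 ∧ p.2 ≠ q.2
    | _, _ => False
  symm := ⟨by
    rintro (u | u | p) (v | v | q) h <;> simp_all [eq_comm, G.adj_comm]⟩
  loopless := ⟨by rintro (u | u | p) <;> simp⟩

/-- The tokens `D` on the first copy, and one token on every extra edge, which has crossed its edge
if the edge belongs to `F`. -/
def slideConfig {V ι : Type} [Fintype ι] [DecidableEq ι] (D : Finset V) (F : Finset ι) :
    Finset (V ⊕ V ⊕ ι × Bool) :=
  D.disjSum ((∅ : Finset V).disjSum
    (Finset.univ.image fun i => (i, decide (i ∈ F))))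

section slide

variable {V ι : Type} [Fintype ι] [DecidableEq ι]
  {G : SimpleGraph V} {D D₁ : Finset V} {F : Finset ι} {ℓ m : ℕ}

@[simp] theorem inl_mem_slideConfig {v : V} : Sum.inl v ∈ slideConfig D F ↔ v ∈ D := by
  simp [slideConfig]

@[simp] theorem inr_inl_notMem_slideConfig {v : V} :
    Sum.inr (Sum.inl v) ∉ slideConfig D F := by
  simp [slideConfig]

@[simp] theorem inr_inr_mem_slideConfig {p : ι × Bool} :
    Sum.inr (Sum.inr p) ∈ slideConfig D F ↔ p.2 = decide (p.1 ∈ F) := by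
  obtain ⟨i, b⟩ := p
  simp only [slideConfig, Finset.inr_mem_disjSum, Finset.mem_image, Finset.mem_univ, true_and,
    Prod.mk.injEq]
  exact ⟨fun ⟨_, h, hb⟩ => h ▸ hb.symm, fun h => ⟨i, rfl, h.symm⟩⟩

theorem card_slideConfig : (slideConfig D F).card = D.card + Fintype.card ι := by
  rw [slideConfig, Finset.card_disjSum, Finset.card_disjSum,
    Finset.card_image_of_injective _ fun _ _ h => (Prod.ext_iff.mp h).1]
  simp

/-- A neighbour in `D` that dominates `v` in `G` serves both copies of `v`: through the clique in
the first, through the closed neighbourhood in the second. Each extra edge carries its own token,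
which dominates both ends. -/
theorem IsDominatingSet.slide (h : IsDominatingSet G D) :
    IsDominatingSet (slideGraph G ι) (slideConfig D F) := by
  rintro (v | v | ⟨i, b⟩)
  · rcases h v with hv | ⟨u, hu, huv⟩
    · exact Or.inl (by simpa using hv)
    · exact Or.inr ⟨.inl u, by simpa using hu, huv.ne⟩
  · rcases h v with hv | ⟨u, hu, huv⟩
    · exact Or.inr ⟨.inl v, by simpa using hv, Or.inl rfl⟩
    · exact Or.inr ⟨.inl u, by simpa using hu, Or.inr huv⟩
  · by_cases hb : b = decide (i ∈ F)
    · exact Or.inl (by simpa using hb)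
    · exact Or.inr ⟨.inr (.inr (i, decide (i ∈ F))), by simp, rfl, fun h => hb h.symm⟩

variable [DecidableEq V]

theorem TokenReaches.slide (h : TokenReaches .jumping G D ℓ D₁) :
    TokenReaches .sliding (slideGraph G ι) (slideConfig D F) ℓ (slideConfig D₁ F) := by
  induction h with
  | refl h => exact .refl h.slide
  | step _ hm hd ih =>
    refine ih.step ?_ hd.slide
    obtain ⟨u, hu, v, hv, -, rfl⟩ := hm
    refine ⟨.inl u, by simpa using hu, .inl v, by simpa using hv, ?_, ?_⟩
    -- The two positions of a jump are distinct, which is all that adjacency in the clique requires.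
    · exact fun h => hv (h ▸ hu)
    · ext (w | w | p) <;> simp

theorem TokenReaches.cross (h : IsDominatingSet G D) (F : Finset ι) :
    TokenReaches .sliding (slideGraph G ι) (slideConfig D ∅) F.card
      (slideConfig D F) := by
  induction F using Finset.induction_on with
  | empty => exact .refl h.slide
  | insert i F hi ih =>
    rw [Finset.card_insert_of_notMem hi]
    refine ih.step ⟨.inr (.inr (i, false)), by simpa using hi, .inr (.inr (i, true)),
      by simpa using hi, ⟨rfl, by simp⟩, ?_⟩ h.slide
    ext (w | w | ⟨j, b⟩)
    · simp
    · simp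
    · by_cases hj : j = i
      · subst hj
        cases b <;> simp
      · simp [hj]

end slide

/-! ### From token sliding back to token jumping -/

/-- Whether a vertex of the sliding graph is in one of the two copies of the original graph. -/
def isCopyVertex {V ι : Type} : V ⊕ V ⊕ ι × Bool → Bool
  | .inr (.inr _) => false
  | _ => true

/-- Whether a vertex of the sliding graph is the far end of an extra edge. -/
def isFarEnd {V ι : Type} : V ⊕ V ⊕ ι × Bool → Bool
  | .inr (.inr (_, b)) => b
  | _ => false

@[simp] theorem isCopyVertex_inl {V ι : Type} (v : V) :
    isCopyVertex (.inl v : V ⊕ V ⊕ ι × Bool) = true := rfl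

@[simp] theorem isCopyVertex_inr_inl {V ι : Type} (v : V) :
    isCopyVertex (.inr (.inl v) : V ⊕ V ⊕ ι × Bool) = true := rfl

@[simp] theorem isCopyVertex_inr_inr {V ι : Type} (p : ι × Bool) :
    isCopyVertex (.inr (.inr p) : V ⊕ V ⊕ ι × Bool) = false := rfl

@[simp] theorem isFarEnd_inl {V ι : Type} (v : V) :
    isFarEnd (.inl v : V ⊕ V ⊕ ι × Bool) = false := rfl

@[simp] theorem isFarEnd_inr_inl {V ι : Type} (v : V) :
    isFarEnd (.inr (.inl v) : V ⊕ V ⊕ ι × Bool) = false := rfl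

@[simp] theorem isFarEnd_inr_inr {V ι : Type} (p : ι × Bool) :
    isFarEnd (.inr (.inr p) : V ⊕ V ⊕ ι × Bool) = p.2 := rfl

/-- The bookkeeping of a single move, free of subtraction. It is applied to the tokens in the
copies, whose number is invariant, and to the occupied far ends. -/
theorem card_filter_insert_erase {α : Type} [DecidableEq α] {S : Finset α} {x y : α} (hx : x ∈ S)
    (hy : y ∉ S) (p : α → Bool) :
    ((insert y (S.erase x)).filter (p ·)).card + (p x).toNat =
      (S.filter (p ·)).card + (p y).toNat := by
  have hy' : y ∉ S.erase x := fun h => hy (Finset.mem_of_mem_erase h)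
  have key : ∀ T : Finset α, (T.filter (p ·)).card = ∑ a ∈ T, (p a).toNat := by
    intro T
    rw [Finset.card_filter]
    exact Finset.sum_congr rfl fun a _ => by cases p a <;> rfl
  rw [key, key, Finset.sum_insert hy', ← Finset.add_sum_erase S _ hx]
  ring

section back

variable {V ι : Type} {G : SimpleGraph V} {D D₁ : Finset V} {m : ℕ}
  {S : Finset (V ⊕ V ⊕ ι × Bool)}

/-- The vertex over `v` in the second copy can only be dominated by itself or from the closed
neighbourhood of `v` in the first copy. Either way the projection of `S`, and so any set `D`
containing it, dominates `v`. -/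
theorem IsDominatingSet.of_slideGraph (h : IsDominatingSet (slideGraph G ι) S)
    (hD : ∀ v, Sum.inl v ∈ S ∨ Sum.inr (Sum.inl v) ∈ S → v ∈ D) : IsDominatingSet G D := by
  intro v
  rcases h (.inr (.inl v)) with hv | ⟨u | u | p, hu, huv⟩
  · exact Or.inl (hD v (Or.inr hv))
  · rcases huv with rfl | huv
    · exact Or.inl (hD u (Or.inl hu))
    · exact Or.inr ⟨u, hD u (Or.inl hu), huv⟩
  · exact huv.elim
  · exact huv.elim

variable [DecidableEq V]

/-- Choosing one token over each vertex of `D` is injective, because a token in the copies lies over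
only one vertex. -/
theorem card_le_card_copyVertices (h : ∀ v ∈ D, Sum.inl v ∈ S ∨ Sum.inr (Sum.inl v) ∈ S) :
    D.card ≤ (S.filter (isCopyVertex ·)).card := by
  classical
  refine Finset.card_le_card_of_injOn
    (fun v => if Sum.inl v ∈ S then Sum.inl v else Sum.inr (Sum.inl v)) ?_ ?_
  · intro v hv
    have := h v hv
    dsimp only
    split_ifs with hs
    · exact Finset.mem_filter.mpr ⟨hs, rfl⟩
    · exact Finset.mem_filter.mpr ⟨this.resolve_left hs, rfl⟩
  · intro v _ w _ hvw
    dsimp only at hvw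
    split_ifs at hvw <;> simpa using hvw

/-- A set containing the projection of a token configuration can follow a move of a token to a
vertex over `v` by at most one jump. -/
theorem exists_jump {D : Finset V} {S' : Finset (V ⊕ V ⊕ ι × Bool)} {v : V}
    (hcard : (S'.filter (isCopyVertex ·)).card ≤ D.card)
    (hdom : IsDominatingSet (slideGraph G ι) S')
    (hsub : ∀ w, Sum.inl w ∈ S' ∨ Sum.inr (Sum.inl w) ∈ S' → w = v ∨ w ∈ D)
    {D₀ : Finset V} {ℓ : ℕ} (hr : TokenReaches .jumping G D₀ ℓ D) :
    ∃ ℓ' ≤ ℓ + 1, ∃ D', TokenReaches .jumping G D₀ ℓ' D' ∧ D'.card = D.card ∧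
      ∀ w, Sum.inl w ∈ S' ∨ Sum.inr (Sum.inl w) ∈ S' → w ∈ D' := by
  by_cases hv : v ∈ D
  · refine ⟨ℓ, by omega, D, hr, rfl, fun w hw => ?_⟩
    rcases hsub w hw with rfl | h
    · exact hv
    · exact h
  by_cases hvS : Sum.inl v ∈ S' ∨ Sum.inr (Sum.inl v) ∈ S'
  -- Some element of `D` is not needed to cover the new projection: otherwise there would be tokens
  -- over all of `insert v D`, more than the copies contain. This spare element jumps to `v`.
  · obtain ⟨u, hu, huS⟩ : ∃ u ∈ D, ¬(Sum.inl u ∈ S' ∨ Sum.inr (Sum.inl u) ∈ S') := by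
      by_contra! hcon
      have := card_le_card_copyVertices (D := insert v D) (S := S') (by
        intro w hw
        rcases Finset.mem_insert.mp hw with rfl | hw
        · exact hvS
        · exact Classical.or_iff_not_imp_left.mpr fun h => (hcon w hw).resolve_left h)
      rw [Finset.card_insert_of_notMem hv] at this
      omega
    have hsub' : ∀ w, Sum.inl w ∈ S' ∨ Sum.inr (Sum.inl w) ∈ S' → w ∈ insert v (D.erase u) := by
      intro w hw
      rcases hsub w hw with rfl | h
      · exact Finset.mem_insert_self _ _
      · exact Finset.mem_insert_of_mem (Finset.mem_erase.mpr ⟨fun h => huS (h ▸ hw), h⟩)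
    refine ⟨ℓ + 1, le_rfl, _, hr.step ⟨u, hu, v, hv, trivial, rfl⟩ (hdom.of_slideGraph hsub'), ?_,
      hsub'⟩
    rw [Finset.card_insert_of_notMem (fun h => hv (Finset.mem_of_mem_erase h)),
      Finset.card_erase_add_one hu]
  · refine ⟨ℓ, by omega, D, hr, rfl, fun w hw => (hsub w hw).resolve_left ?_⟩
    rintro rfl
    exact hvS hw

variable [Fintype ι] [DecidableEq ι]

/-- The invariant of the simulation. The last clause is only an inequality, since a slide may need
no jump, and a token on an extra edge may slide back. -/
theorem TokenReaches.of_slideGraph (hD : IsDominatingSet G D)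
    (h : TokenReaches .sliding (slideGraph G ι) (slideConfig D ∅) m S) :
    (S.filter (isCopyVertex ·)).card = D.card ∧
    ∃ ℓ D₁, TokenReaches .jumping G D ℓ D₁ ∧ D₁.card = D.card ∧
      (∀ v, Sum.inl v ∈ S ∨ Sum.inr (Sum.inl v) ∈ S → v ∈ D₁) ∧
      ℓ + (S.filter (isFarEnd ·)).card ≤ m := by
  induction h with
  | refl h =>
    have h₁ : (slideConfig D (∅ : Finset ι)).filter (isCopyVertex ·) =
        D.map Function.Embedding.inl := by
      ext (v | v | p) <;> simp
    have h₂ : (slideConfig D (∅ : Finset ι)).filter (isFarEnd ·) = ∅ := by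
      ext (v | v | p) <;> simp
    exact ⟨by simp [h₁], 0, D, .refl hD, rfl, by simp, by simp [h₂]⟩
  | @step m S S' _ hm hd ih =>
    obtain ⟨hc, ℓ, D₁, hr, hc₁, hsub, hle⟩ := ih
    obtain ⟨x, hx, y, hy, hxy, rfl⟩ := hm
    have hcopy := card_filter_insert_erase hx hy isCopyVertex
    have hfar := card_filter_insert_erase hx hy isFarEnd
    -- All slides inside the two copies at once, where `v` is the vertex under the target `y`: the
    -- far ends do not change and at most one jump is spent.
    have main : ∀ v, isCopyVertex x = true → isCopyVertex y = true → isFarEnd x = false →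
        isFarEnd y = false → (∀ w, Sum.inl w = y ∨ Sum.inr (Sum.inl w) = y → w = v) →
        ((insert y (S.erase x)).filter (isCopyVertex ·)).card = D.card ∧
        ∃ ℓ D₁, TokenReaches .jumping G D ℓ D₁ ∧ D₁.card = D.card ∧
        (∀ v, Sum.inl v ∈ insert y (S.erase x) ∨ Sum.inr (Sum.inl v) ∈ insert y (S.erase x) →
          v ∈ D₁) ∧ ℓ + ((insert y (S.erase x)).filter (isFarEnd ·)).card ≤ m + 1 := by
      intro v hx₁ hy₁ hx₂ hy₂ hv
      rw [hx₁, hy₁] at hcopy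
      rw [hx₂, hy₂] at hfar
      have hc' : ((insert y (S.erase x)).filter (isCopyVertex ·)).card = D.card := by omega
      refine ⟨hc', ?_⟩
      obtain ⟨ℓ', hℓ', D', hr', hcD', hs'⟩ := exists_jump (v := v) (by omega) hd (by
        rintro w (hw | hw)
        · rcases Finset.mem_insert.mp hw with h | h
          · exact Or.inl (hv w (Or.inl h))
          · exact Or.inr (hsub w (Or.inl (Finset.mem_of_mem_erase h)))
        · rcases Finset.mem_insert.mp hw with h | h
          · exact Or.inl (hv w (Or.inr h))
          · exact Or.inr (hsub w (Or.inr (Finset.mem_of_mem_erase h)))) hr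
      exact ⟨ℓ', D', hr', by omega, hs', by omega⟩
    rcases x with u | u | p <;> rcases y with v | v | q
    · exact main v rfl rfl rfl rfl (by simp)
    · exact main v rfl rfl rfl rfl (by simp)
    · exact hxy.elim
    · exact main v rfl rfl rfl rfl (by simp)
    · exact hxy.elim
    · exact hxy.elim
    · exact hxy.elim
    · exact hxy.elim
    -- A slide along an extra edge leaves the projection alone, and its cost pays for at most one
    -- new far end.
    · have hp : (isFarEnd (Sum.inr (Sum.inr q) : V ⊕ V ⊕ ι × Bool)).toNat ≤ 1 := Bool.toNat_le _
      refine ⟨hcopy.trans hc, ℓ, D₁, hr, hc₁, ?_, by omega⟩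
      rintro v (hv | hv)
      · exact hsub v (Or.inl (by simpa using hv))
      · exact hsub v (Or.inr (by simpa using hv))

theorem TokenReaches.of_slideConfig (hD : IsDominatingSet G D) (hc : D.card = D₁.card)
    (h : TokenReaches .sliding (slideGraph G ι) (slideConfig D ∅) m
      (slideConfig D₁ Finset.univ)) :
    ∃ ℓ, ℓ + Fintype.card ι ≤ m ∧ TokenReaches .jumping G D ℓ D₁ := by
  obtain ⟨-, ℓ, D₂, hr, hc₂, hsub, hle⟩ := h.of_slideGraph hD
  have hfar : (slideConfig D₁ (Finset.univ : Finset ι)).filter (isFarEnd ·) =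
      Finset.univ.image fun i : ι => Sum.inr (Sum.inr (i, true)) := by
    ext (v | v | ⟨i, b⟩)
    · simp
    · simp
    · cases b <;> simp
  -- In the final configuration the projection is all of `D₁`, which already has the size of the set
  -- followed.
  have : D₁ = D₂ := Finset.eq_of_subset_of_card_le
    (fun v hv => hsub v (Or.inl (by simpa using hv))) (by omega)
  subst this
  refine ⟨ℓ, ?_, hr⟩
  rwa [hfar, Finset.card_image_of_injective _ fun _ _ h => by simpa using h,
    Finset.card_univ] at hle

end back

/-! ### The reduction -/

/-- The numbering of the vertices of the sliding graph. -/
def slideEquiv (n k : ℕ) :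
    Fin n ⊕ Fin n ⊕ Fin (k + 1) × Bool ≃ Fin (n + (n + (k + 1) * 2)) :=
  ((Equiv.refl _).sumCongr (((Equiv.refl _).sumCongr
    (((Equiv.refl _).prodCongr finTwoEquiv.symm).trans finProdFinEquiv)).trans
      finSumFinEquiv)).trans finSumFinEquiv

theorem slideEquiv_inl {n k : ℕ} (v : Fin n) : (slideEquiv n k (.inl v) : ℕ) = v := rfl

theorem slideEquiv_inr_inl {n k : ℕ} (v : Fin n) :
    (slideEquiv n k (.inr (.inl v)) : ℕ) = n + v := rfl

/-- As the offset `2 * n` is even, the parity of the number tells the end of an extra edge, and half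
the number tells the edge. The machine relies on both. -/
theorem slideEquiv_inr_inr {n k : ℕ} (i : Fin (k + 1)) (b : Bool) :
    (slideEquiv n k (.inr (.inr (i, b))) : ℕ) = n + (n + (b.toNat + 2 * i)) := by
  cases b <;> rfl

/-- The reduction from Token Jumping to Token Sliding. -/
def DSRInstance.toSliding (A : DSRInstance) : DSRInstance where
  n := A.n + (A.n + (A.k + 1) * 2)
  G := (slideGraph A.G (Fin (A.k + 1))).comap (slideEquiv A.n A.k).symm
  init := (slideConfig A.init ∅).map (slideEquiv A.n A.k).toEmbedding
  fin := (slideConfig A.fin Finset.univ).map (slideEquiv A.n A.k).toEmbedding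
  k := A.k + (A.k + 1)
  card_init := by simp [card_slideConfig, A.card_init]
  card_fin := by simp [card_slideConfig, A.card_fin]
  dom_init := A.dom_init.slide.map (SimpleGraph.Iso.comap (slideEquiv A.n A.k).symm _).symm
  dom_fin := A.dom_fin.slide.map (SimpleGraph.Iso.comap (slideEquiv A.n A.k).symm _).symm

theorem DSRInstance.toSliding_hasSeq_iff (A : DSRInstance) (m : ℕ) :
    A.toSliding.HasSeq .sliding m ↔
      TokenReaches .sliding (slideGraph A.G (Fin (A.k + 1))) (slideConfig A.init ∅) m
        (slideConfig A.fin Finset.univ) := by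
  rw [DSRInstance.hasSeq_iff]
  let e := SimpleGraph.Iso.comap (slideEquiv A.n A.k).symm (slideGraph A.G (Fin (A.k + 1)))
  constructor
  · intro h
    have := h.map e
    simpa [e, DSRInstance.toSliding, Finset.map_map, SimpleGraph.Iso.comap] using this
  · exact fun h => h.map e.symm

theorem DSRInstance.HasSeq.toSliding {A : DSRInstance} {ℓ : ℕ} (h : A.HasSeq .jumping ℓ) :
    A.toSliding.HasSeq .sliding (ℓ + A.k + 1) := by
  rw [A.toSliding_hasSeq_iff]
  rw [A.hasSeq_iff] at h
  have := (h.slide (ι := Fin (A.k + 1)) (F := ∅)).trans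
    (.cross A.dom_fin Finset.univ)
  simpa [add_assoc] using this

theorem DSRInstance.HasSeq.of_toSliding {A : DSRInstance} {m : ℕ}
    (h : A.toSliding.HasSeq .sliding m) : ∃ ℓ, ℓ + A.k + 1 ≤ m ∧ A.HasSeq .jumping ℓ := by
  rw [A.toSliding_hasSeq_iff] at h
  obtain ⟨ℓ, hℓ, hr⟩ := h.of_slideConfig A.dom_init (A.card_init.trans A.card_fin.symm)
  exact ⟨ℓ, by simpa [add_assoc] using hℓ, (A.hasSeq_iff _ _).mpr hr⟩

/-! ### Compiling arithmetic expressions to register programs -/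

/-- Arithmetic expressions in `m` variables, with access to the input. -/
inductive RegExpr (m : ℕ) where
  | var (i : Fin m)
  | const (c : ℕ)
  | arith (o : ArithOp) (a b : RegExpr m)
  /-- the input symbol at the position `a` -/
  | read (a : RegExpr m)
  /-- if `c` is nonzero then `a` else `b` -/
  | ite (c a b : RegExpr m)

namespace RegExpr

variable {m s : ℕ}

/-- The value of an expression on the input `x`. -/
def eval (x : List Bool) (ρ : Fin m → ℕ) : RegExpr m → ℕ
  | var i => ρ i
  | const c => c
  | arith o a b => o.eval (a.eval x ρ) (b.eval x ρ)
  | read a => inputSymbol x (a.eval x ρ)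
  | ite c a b => if c.eval x ρ ≠ 0 then a.eval x ρ else b.eval x ρ

/-- The number of auxiliary registers beyond the first that evaluation needs. -/
def depth : RegExpr m → ℕ
  | var _ => 0
  | const _ => 0
  | arith _ a b => max a.depth (b.depth + 1)
  | read a => a.depth
  | ite c a b => max c.depth (max a.depth b.depth)

/-- The degree of a polynomial bound on all values occurring in the evaluation. -/
def weight : RegExpr m → ℕ
  | var _ => 1
  | const c => c + 1
  | arith _ a b => a.weight + b.weight
  | read a => a.weight + 2
  | ite c a b => c.weight + a.weight + b.weight

theorem weight_pos (e : RegExpr m) : 1 ≤ e.weight := by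
  induction e <;> simp only [weight] <;> omega

end RegExpr

theorem inputSymbol_le (x : List Bool) (a : ℕ) : inputSymbol x a ≤ 2 := by
  unfold inputSymbol
  split <;> omega

theorem ArithOp.eval_le (o : ArithOp) (a b : ℕ) : o.eval a b ≤ max (a + b) (a * b) := by
  cases o
  · exact le_max_left _ _
  · exact le_max_of_le_left ((Nat.sub_le _ _).trans (Nat.le_add_right _ _))
  · exact le_max_right _ _
  · exact le_max_of_le_left ((Nat.div_le_self _ _).trans (Nat.le_add_right _ _))
  · exact le_max_of_le_left ((Nat.mod_le _ _).trans (Nat.le_add_right _ _))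

/-- Weights add under every binary operation, as exponents do under multiplication. Sums obey the
same bound because `a + b ≤ a * b` for `a, b ≥ 2`; this is why `2 ≤ N` and positive weights are
needed. -/
theorem RegExpr.eval_le {m N : ℕ} (hN : 2 ≤ N) (x : List Bool) {ρ : Fin m → ℕ} (hρ : ∀ i, ρ i ≤ N)
    (e : RegExpr m) : e.eval x ρ ≤ N ^ e.weight := by
  have hpow : ∀ e : RegExpr m, 2 ≤ N ^ e.weight := fun e =>
    hN.trans (Nat.le_self_pow (Nat.one_le_iff_ne_zero.mp e.weight_pos) N)
  induction e with
  | var i => simpa [eval, weight] using hρ i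
  | const c =>
    have h : c < N ^ c := Nat.lt_pow_self (by omega)
    exact h.le.trans (Nat.pow_le_pow_right (by omega) (Nat.le_succ c))
  | arith o a b iha ihb =>
    refine (o.eval_le _ _).trans (max_le ?_ ?_) <;> rw [weight, pow_add]
    · exact (Nat.add_le_add iha ihb).trans (Nat.add_le_mul (hpow a) (hpow b))
    · exact Nat.mul_le_mul iha ihb
  | read a =>
    exact (inputSymbol_le _ _).trans (hpow (.read a))
  | ite c a b _ iha ihb =>
    rw [eval]
    split_ifs
    · exact iha.trans (Nat.pow_le_pow_right (by omega) (by simp only [weight]; omega))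
    · exact ihb.trans (Nat.pow_le_pow_right (by omega) (by simp only [weight]; omega))

section compile

variable {m s : ℕ}

/-- The register of a variable. -/
def varReg (i : Fin m) : Fin (m + (s + 1)) := Fin.castAdd (s + 1) i

/-- The `j`-th auxiliary register. -/
def auxReg (j : ℕ) : Fin (m + (s + 1)) := Fin.natAdd m (Fin.ofNat (s + 1) j)

theorem varReg_injective : Function.Injective (varReg : Fin m → Fin (m + (s + 1))) :=
  Fin.castAdd_injective m (s + 1)

theorem varReg_ne_auxReg (i : Fin m) (j : ℕ) : (varReg i : Fin (m + (s + 1))) ≠ auxReg j := by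
  intro h
  have := congrArg Fin.val h
  simp only [varReg, auxReg, Fin.val_castAdd, Fin.val_natAdd] at this
  omega

/-- The index of `auxReg` wraps around modulo `s + 1`, so distinctness needs both indices in range;
the depth condition on expressions guarantees this. -/
theorem auxReg_ne {i j : ℕ} (hi : i ≤ s) (hj : j ≤ s) (hij : i ≠ j) :
    (auxReg i : Fin (m + (s + 1))) ≠ auxReg j := by
  intro h
  have := congrArg Fin.val h
  simp only [auxReg, Fin.val_natAdd, Fin.val_ofNat, Nat.mod_eq_of_lt (Nat.lt_succ_of_le hi),
    Nat.mod_eq_of_lt (Nat.lt_succ_of_le hj)] at this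
  omega

/-- A program that evaluates an expression into the `t`-th auxiliary register. -/
def RegExpr.compile : RegExpr m → ℕ → RegProg (m + (s + 1))
  | var i, t => .seq (.instr (.const (auxReg t) 0))
      (.instr (.arith .add (auxReg t) (auxReg t) (varReg i)))
  | const c, t => .instr (.const (auxReg t) c)
  | arith o a b, t => .seq (a.compile t) (.seq (b.compile (t + 1))
      (.instr (.arith o (auxReg t) (auxReg t) (auxReg (t + 1)))))
  | read a, t => .seq (a.compile t) (.instr (.read (auxReg t) (auxReg t)))
  | ite c a b, t => .seq (c.compile t) (.branch (auxReg t) (a.compile t) (b.compile t))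

theorem RegConfig.space_le {R B sp : ℕ} {c : RegConfig R} (h : ∀ r, c.reg r ≤ B)
    (hs : R * B.size ≤ sp) : c.space ≤ sp := by
  refine le_trans ?_ hs
  simpa [RegConfig.space] using
    Finset.sum_le_card_nsmul Finset.univ (fun r => (c.reg r).size) B.size
      fun r _ => Nat.size_le_size (h r)

/-- The configuration `c` holds the values `ρ` of the variables and the output `o`, and all its
registers are bounded by `B`. -/
structure RegConfig.Holds (B : ℕ) (c : RegConfig (m + (s + 1))) (ρ : Fin m → ℕ) (o : List Bool) :
    Prop where
  var : ∀ i, c.reg (varReg i) = ρ i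
  out : c.out = o
  le : ∀ r, c.reg r ≤ B

variable {B sp N : ℕ} {x : List Bool} {c : RegConfig (m + (s + 1))} {ρ : Fin m → ℕ}
  {o : List Bool}

theorem RegConfig.Holds.space_le (h : c.Holds B ρ o) (hs : (m + (s + 1)) * B.size ≤ sp) :
    c.space ≤ sp := RegConfig.space_le h.le hs

theorem RegProg.Runs.instr_of_eq {R : ℕ} {i : RegInstr R} {c d : RegConfig R}
    (h : i.step x c = d) (hd : d.space ≤ sp) : RegProg.Runs x sp (.instr i) c d := by
  subst h
  exact .instr i c hd

theorem RegConfig.Holds.update_aux (h : c.Holds B ρ o) {t v : ℕ} (hv : v ≤ B) :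
    RegConfig.Holds B { c with reg := Function.update c.reg (auxReg t) v } ρ o where
  var i := (Function.update_of_ne (varReg_ne_auxReg i t) _ _).trans (h.var i)
  out := h.out
  le r := by
    by_cases hr : r = auxReg t
    · subst hr
      simpa using hv
    · simpa [hr] using h.le r

theorem RegConfig.Holds.update_var (h : c.Holds B ρ o) {i : Fin m} {v : ℕ} (hv : v ≤ B) :
    RegConfig.Holds B { c with reg := Function.update c.reg (varReg i) v }
      (Function.update ρ i v) o where
  var j := by
    by_cases hj : j = i
    · subst hj
      simp
    · simp [hj, varReg_injective.ne hj, h.var]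
  out := h.out
  le r := by
    by_cases hr : r = varReg i
    · subst hr
      simpa using hv
    · simpa [hr] using h.le r

/-- The auxiliary registers form a stack with top `t`. The final clause, that nothing below `t`
changes, carries the induction. `N` bounds the variables, while `B` bounds all registers at all
times and so controls the space. -/
theorem RegExpr.compile_runs (hN : 2 ≤ N) (hs : (m + (s + 1)) * B.size ≤ sp)
    (hρ : ∀ i, ρ i ≤ N) (e : RegExpr m) :
    ∀ {t : ℕ} {c : RegConfig (m + (s + 1))}, t + e.depth ≤ s → N ^ e.weight ≤ B → c.Holds B ρ o →
      ∃ d, (e.compile t).Runs x sp c d ∧ d.Holds B ρ o ∧ d.reg (auxReg t) = e.eval x ρ ∧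
        ∀ j < t, d.reg (auxReg j) = c.reg (auxReg j) := by
  have hpow : ∀ {a b : ℕ}, a ≤ b → N ^ b ≤ B → N ^ a ≤ B := fun h hb =>
    (Nat.pow_le_pow_right (by omega) h).trans hb
  have hev : ∀ {e : RegExpr m}, N ^ e.weight ≤ B → e.eval x ρ ≤ B := fun {e} h =>
    (e.eval_le hN x hρ).trans h
  induction e with
  | var i =>
    intro t c ht hB hc
    have h₁ := hc.update_aux (t := t) (Nat.zero_le B)
    have h₂ := h₁.update_aux (t := t) (hev hB)
    rw [Function.update_idem] at h₂
    refine ⟨_, .seq (.instr _ _ (h₁.space_le hs)) (.instr_of_eq ?_ (h₂.space_le hs)), h₂, by simp,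
      fun j hj => ?_⟩
    · simp only [RegInstr.step, ArithOp.eval, Function.update_self, Function.update_idem, zero_add,
        Function.update_of_ne (varReg_ne_auxReg i t), hc.var, RegExpr.eval]
    · simp only [depth] at ht
      exact Function.update_of_ne (auxReg_ne (by omega) (by omega) (by omega)) _ _
  | const v =>
    intro t c ht hB hc
    have h₁ := hc.update_aux (t := t) (hev hB)
    refine ⟨_, .instr _ _ (h₁.space_le hs), h₁, Function.update_self .., fun j hj => ?_⟩
    simp only [depth] at ht
    exact Function.update_of_ne (auxReg_ne (by omega) (by omega) (by omega)) _ _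
  | arith op a b iha ihb =>
    intro t c ht hB hc
    simp only [depth] at ht
    have hval := hev hB
    simp only [weight] at hB
    obtain ⟨d, hd, hdh, hdv, hdj⟩ :=
      iha (t := t) (by omega) (hpow (by omega) hB) hc
    obtain ⟨d', hd', hdh', hdv', hdj'⟩ :=
      ihb (t := t + 1) (by omega) (hpow (by omega) hB) hdh
    have h₁ := hdh'.update_aux (t := t) hval
    -- The left operand in register `t` has survived the evaluation of the right one, which worked
    -- from `t + 1` upwards.
    have heq : RegInstr.step x (.arith op (auxReg t) (auxReg t) (auxReg (t + 1))) d' =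
        { d' with reg := Function.update d'.reg (auxReg t) ((arith op a b).eval x ρ) } := by
      simp only [RegInstr.step, eval, hdv', hdj' t (by omega), hdv]
    refine ⟨_, .seq hd (.seq hd' (.instr_of_eq heq (h₁.space_le hs))), h₁, by simp,
      fun j hj => ?_⟩
    · have := auxReg_ne (m := m) (s := s) (i := j) (j := t) (by omega) (by omega) (by omega)
      simp [this, hdj' j (by omega), hdj j hj]
  | read a iha =>
    intro t c ht hB hc
    have hval := hev hB
    simp only [weight] at hB
    obtain ⟨d, hd, hdh, hdv, hdj⟩ := iha ht (hpow (by omega) hB) hc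
    have h₁ := hdh.update_aux (t := t) hval
    have heq : RegInstr.step x (.read (auxReg t) (auxReg t)) d =
        { d with reg := Function.update d.reg (auxReg t) ((read a).eval x ρ) } := by
      simp only [RegInstr.step, eval, hdv]
    refine ⟨_, .seq hd (.instr_of_eq heq (h₁.space_le hs)), h₁, by simp, fun j hj => ?_⟩
    · simp only [depth] at ht
      have := auxReg_ne (m := m) (s := s) (i := j) (j := t) (by omega) (by omega) (by omega)
      simp [this, hdj j hj]
  | ite e a b ihe iha ihb =>
    intro t c ht hB hc
    simp only [depth] at ht
    simp only [weight] at hB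
    obtain ⟨d, hd, hdh, hdv, hdj⟩ := ihe (t := t) (by omega) (hpow (by omega) hB) hc
    by_cases hz : e.eval x ρ = 0
    · obtain ⟨d', hd', hdh', hdv', hdj'⟩ := ihb (t := t) (by omega) (hpow (by omega) hB) hdh
      exact ⟨d', .seq hd (.branch_neg (hdv.trans hz) hd'), hdh', by simp [eval, hz, hdv'],
        fun j hj => (hdj' j hj).trans (hdj j hj)⟩
    · obtain ⟨d', hd', hdh', hdv', hdj'⟩ := iha (t := t) (by omega) (hpow (by omega) hB) hdh
      exact ⟨d', .seq hd (.branch_pos (by rwa [hdv]) hd'), hdh', by simp [eval, hz, hdv'],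
        fun j hj => (hdj' j hj).trans (hdj j hj)⟩

/-! ### Commands -/

/-- The command `v := e`. -/
def assign (v : Fin m) (e : RegExpr m) : RegProg (m + (s + 1)) :=
  .seq (e.compile 0) (.seq (.instr (.const (varReg v) 0))
    (.instr (.arith .add (varReg v) (varReg v) (auxReg 0))))

/-- The command that writes `1` if `e` is nonzero, and `0` otherwise. -/
def emit (e : RegExpr m) : RegProg (m + (s + 1)) :=
  .seq (e.compile 0) (.branch (auxReg 0) (.instr (.write true)) (.instr (.write false)))

/-- On input `x`, the program `p` takes the values `ρ` of the variables and the output `o` to `ρ'`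
and `o'`, in space `sp` and with all registers bounded by `B`. -/
def Executes (x : List Bool) (sp B : ℕ) (p : RegProg (m + (s + 1))) (ρ : Fin m → ℕ)
    (o : List Bool) (ρ' : Fin m → ℕ) (o' : List Bool) : Prop :=
  ∀ c, RegConfig.Holds B c ρ o → ∃ d, p.Runs x sp c d ∧ d.Holds B ρ' o'

namespace Executes

variable {p q : RegProg (m + (s + 1))} {ρ₁ ρ₂ : Fin m → ℕ} {o₁ o₂ : List Bool} {v : Fin m}

theorem seq (hp : Executes x sp B p ρ o ρ₁ o₁) (hq : Executes x sp B q ρ₁ o₁ ρ₂ o₂) :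
    Executes x sp B (.seq p q) ρ o ρ₂ o₂ := by
  intro c hc
  obtain ⟨d, hd, hdh⟩ := hp c hc
  obtain ⟨d', hd', hdh'⟩ := hq d hdh
  exact ⟨d', .seq hd hd', hdh'⟩

theorem loop_done (hv : ρ v = 0) : Executes x sp B (.loop (varReg v) p) ρ o ρ o :=
  fun c hc => ⟨c, .loop_done ((hc.var v).trans hv), hc⟩

theorem loop_step (hv : ρ v ≠ 0) (hp : Executes x sp B p ρ o ρ₁ o₁)
    (hq : Executes x sp B (.loop (varReg v) p) ρ₁ o₁ ρ₂ o₂) :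
    Executes x sp B (.loop (varReg v) p) ρ o ρ₂ o₂ := by
  intro c hc
  obtain ⟨d, hd, hdh⟩ := hp c hc
  obtain ⟨d', hd', hdh'⟩ := hq d hdh
  exact ⟨d', .loop_step (by rwa [hc.var]) hd hd', hdh'⟩

theorem assign (hN : 2 ≤ N) (hs : (m + (s + 1)) * B.size ≤ sp) (hρ : ∀ i, ρ i ≤ N)
    {e : RegExpr m} (he : e.depth ≤ s) (hB : N ^ e.weight ≤ B) (v : Fin m) :
    Executes x sp B (assign (s := s) v e) ρ o (Function.update ρ v (e.eval x ρ)) o := by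
  intro c hc
  obtain ⟨d, hd, hdh, hdv, -⟩ :=
    e.compile_runs (x := x) hN hs hρ (t := 0) (by omega) hB hc
  -- There is no copy instruction: the variable is first cleared and then the result is added to it.
  have h₁ := hdh.update_var (i := v) (Nat.zero_le B)
  have h₂ := h₁.update_var (i := v) ((e.eval_le hN x hρ).trans hB)
  rw [Function.update_idem, Function.update_idem] at h₂
  refine ⟨_, .seq hd (.seq (.instr _ _ (h₁.space_le hs)) (.instr_of_eq ?_ (h₂.space_le hs))), h₂⟩
  simp only [RegInstr.step, ArithOp.eval, Function.update_self, Function.update_idem, zero_add,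
    Function.update_of_ne (varReg_ne_auxReg v 0).symm, hdv]

theorem emit (hN : 2 ≤ N) (hs : (m + (s + 1)) * B.size ≤ sp) (hρ : ∀ i, ρ i ≤ N)
    {e : RegExpr m} (he : e.depth ≤ s) (hB : N ^ e.weight ≤ B) :
    Executes x sp B (emit (s := s) e) ρ o ρ (o ++ [decide (e.eval x ρ ≠ 0)]) := by
  intro c hc
  obtain ⟨d, hd, hdh, hdv, -⟩ :=
    e.compile_runs (x := x) hN hs hρ (t := 0) (by omega) hB hc
  by_cases hz : e.eval x ρ = 0
  · refine ⟨_, .seq hd (.branch_neg (hdv.trans hz) (.instr _ _ (hdh.space_le hs))), hdh.var, ?_,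
      hdh.le⟩
    simp [RegInstr.step, hdh.out, hz]
  · refine ⟨_, .seq hd (.branch_pos (by rwa [hdv]) (.instr _ _ (hdh.space_le hs))), hdh.var, ?_,
      hdh.le⟩
    simp [RegInstr.step, hdh.out, hz]

end Executes

end compile

/-! ### Scanning a block of ones, and writing a block of the output -/

section blocks

variable {s B sp N : ℕ} {x : List Bool} {o : List Bool} {a b c d : ℕ}

theorem update_vec_zero (v : ℕ) : Function.update ![a, b, c, d] 0 v = ![v, b, c, d] := by
  ext i; fin_cases i <;> rfl

theorem update_vec_one (v : ℕ) : Function.update ![a, b, c, d] 1 v = ![a, v, c, d] := by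
  ext i; fin_cases i <;> rfl

theorem update_vec_two (v : ℕ) : Function.update ![a, b, c, d] 2 v = ![a, b, v, d] := by
  ext i; fin_cases i <;> rfl

theorem update_vec_three (v : ℕ) : Function.update ![a, b, c, d] 3 v = ![a, b, c, v] := by
  ext i; fin_cases i <;> rfl

theorem vec_le (ha : a ≤ N) (hb : b ≤ N) (hc : c ≤ N) (hd : d ≤ N) (i : Fin 4) :
    ![a, b, c, d] i ≤ N := by
  fin_cases i <;> assumption

/-- Writes the bits `bit` at the positions less than `len`, where variable `3` is the position. -/
def writeBlock (len bit : RegExpr 4) : RegProg (4 + (s + 1)) :=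
  .seq (assign 3 (.const 0)) (.seq (assign 2 len) (.loop (varReg 2) (.seq (emit bit)
    (.seq (assign 3 (.arith .add (.var 3) (.const 1)))
      (assign 2 (.arith .sub (.var 2) (.const 1)))))))

/-- Variable `2` counts down while variable `3` counts up, with constant sum `L`. The bit may depend
on the position `i` but not on the countdown `j`, hence the quantifier over `j` in `hg`. -/
theorem Executes.writeBlock {len bit : RegExpr 4} {L : ℕ} {g : ℕ → Bool} (hN : 2 ≤ N)
    (hs : (4 + (s + 1)) * B.size ≤ sp) (ha : a ≤ N) (hb : b ≤ N) (hc : c ≤ N) (hd : d ≤ N)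
    (hL : L ≤ N) (hs₁ : 1 ≤ s) (hlen : len.depth ≤ s) (hbit : bit.depth ≤ s) (hB₀ : N ^ 3 ≤ B)
    (hB₁ : N ^ len.weight ≤ B) (hB₂ : N ^ bit.weight ≤ B)
    (hlen_eval : len.eval x ![a, b, c, 0] = L)
    (hg : ∀ i < L, ∀ j, (bit.eval x ![a, b, j, i] ≠ 0 ↔ g i = true)) :
    Executes x sp B (writeBlock (s := s) len bit) ![a, b, c, d] o ![a, b, 0, L]
      (o ++ (List.range L).map g) := by
  have hN1 : N ^ 1 ≤ B := (Nat.pow_le_pow_right (by omega) (by omega)).trans hB₀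
  refine .seq (Executes.assign hN hs (vec_le ha hb hc hd) (e := .const 0) (Nat.zero_le s) hN1 3) ?_
  rw [update_vec_three]
  refine .seq (Executes.assign hN hs (vec_le ha hb hc (Nat.zero_le N)) hlen hB₁ 2) ?_
  rw [update_vec_two]
  change Executes x sp B _ ![a, b, len.eval x ![a, b, c, 0], 0] _ _ _
  rw [hlen_eval]
  suffices h : ∀ j i, i + j = L → Executes x sp B (.loop (varReg 2) _) ![a, b, j, i]
      (o ++ (List.range i).map g) ![a, b, 0, L] (o ++ (List.range L).map g) by
    simpa using h L 0 (by omega)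
  intro j
  induction j with
  | zero =>
    rintro i rfl
    exact Executes.loop_done rfl
  | succ j ih =>
    intro i hi
    refine Executes.loop_step (by simp) (.seq (Executes.emit hN hs
      (vec_le ha hb (by omega) (by omega)) hbit hB₂) (.seq (Executes.assign hN hs
      (vec_le ha hb (by omega) (by omega)) (e := .arith .add (.var 3) (.const 1)) hs₁ hB₀ 3)
      (Executes.assign hN hs (fun r => ?_) (e := .arith .sub (.var 2) (.const 1)) hs₁ hB₀ 2))) ?_
    · rw [update_vec_three]
      exact vec_le ha hb (by omega) (show i + 1 ≤ N by omega) r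
    · rw [update_vec_three, update_vec_two]
      have := ih (i + 1) (by omega)
      rw [List.range_succ, List.map_append, ← List.append_assoc] at this
      have hgi : decide (bit.eval x ![a, b, j + 1, i] ≠ 0) = g i := by
        rw [Bool.eq_iff_iff, decide_eq_true_iff, hg i (by omega)]
      rw [hgi]
      exact this

/-- Increases variable `v` as long as the input symbol at the position `e` is nonzero. -/
def scanBlock (v : Fin 4) (e : RegExpr 4) : RegProg (4 + (s + 1)) :=
  .seq (assign 2 (.read e)) (.loop (varReg 2) (.seq (assign v (.arith .add (.var v) (.const 1)))
    (assign 2 (.read e))))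

/-- Here `f i j` is the state after counting `i` ones, with `j` in variable `2`, the last symbol
read. Abstracting the state this way covers the scans for `n` and for `k` by one argument. -/
theorem Executes.scanBlock {v : Fin 4} {e : RegExpr 4} {L : ℕ} {f : ℕ → ℕ → Fin 4 → ℕ}
    (hN : 2 ≤ N) (hs : (4 + (s + 1)) * B.size ≤ sp) (hs₁ : 1 ≤ s) (he : e.depth ≤ s)
    (hB₀ : N ^ 3 ≤ B) (hB₁ : N ^ (e.weight + 2) ≤ B)
    (hf : ∀ i ≤ L, ∀ j ≤ 2, ∀ r, f i j r ≤ N) (hv : ∀ i j, f i j v = i)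
    (h2 : ∀ i j, f i j 2 = j) (hfv : ∀ i i' j, Function.update (f i j) v i' = f i' j)
    (hf2 : ∀ i j j', Function.update (f i j) 2 j' = f i j')
    (hone : ∀ i < L, ∀ j, inputSymbol x (e.eval x (f i j)) = 1)
    (hzero : ∀ j, inputSymbol x (e.eval x (f L j)) = 0) :
    Executes x sp B (scanBlock (s := s) v e) (f 0 0) o (f L 0) o := by
  refine .seq (Executes.assign hN hs (hf 0 (Nat.zero_le L) 0 (by omega)) (e := .read e)
    he hB₁ 2) ?_
  rw [hf2]
  suffices h : ∀ j i y, i + j = L → Executes x sp B (.loop (varReg 2) _)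
      (f i (inputSymbol x (e.eval x (f i y)))) o (f L 0) o by
    exact h L 0 0 (by omega)
  intro j
  induction j with
  | zero =>
    rintro i y hi
    obtain rfl : i = L := hi
    rw [hzero]
    exact Executes.loop_done (h2 _ _)
  | succ j ih =>
    intro i y hi
    rw [hone i (by omega)]
    refine Executes.loop_step (by simp [h2]) (.seq (Executes.assign hN hs
      (hf i (by omega) 1 (by omega)) (e := .arith .add (.var v) (.const 1)) hs₁ hB₀ v)
      (Executes.assign hN hs (fun r => ?_) (e := .read e) he hB₁ 2)) ?_
    · simp only [RegExpr.eval, ArithOp.eval, hv, hfv]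
      exact hf _ (by omega) 1 (by omega) r
    · simp only [RegExpr.eval, ArithOp.eval, hv, hfv, hf2]
      exact ih (i + 1) 1 (by omega)

end blocks

/-! ### Reading and writing encodings -/

theorem inputSymbol_append {l l' : List Bool} {b : Bool} {a : ℕ} (ha : a = l.length) :
    inputSymbol (l ++ b :: l') a = b.toNat := by
  have h : (l ++ b :: l')[a]? = some b := by
    subst ha
    simp
  rw [inputSymbol, h]
  cases b <;> rfl

theorem inputSymbol_append_ofFn {l l' : List Bool} {n a : ℕ} {f : Fin n → Bool} (i : Fin n)
    (ha : a = l.length + i) : inputSymbol (l ++ (List.ofFn f ++ l')) a = (f i).toNat := by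
  have h : (l ++ (List.ofFn f ++ l'))[a]? = some (f i) := by
    rw [ha, List.getElem?_append_right (by omega), Nat.add_sub_cancel_left,
      List.getElem?_append_left (by simp)]
    simp
  rw [inputSymbol, h]
  cases f i <;> rfl

theorem map_range_eq_ofFn {α : Type} {n : ℕ} {g : ℕ → α} {f : Fin n → α}
    (h : ∀ i : Fin n, g i = f i) :
    (List.range n).map g = List.ofFn f := by
  apply List.ext_getElem
  · simp
  · intro i hi hi'
    simp only [List.length_ofFn] at hi'
    simpa using h ⟨i, hi'⟩

/-- Makes the adjacency matrix a single block indexed by position, so that the machine recovers row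
and column by division with remainder. -/
theorem flatMap_finRange_eq_ofFn {α : Type} {n : ℕ} (F : Fin n → Fin n → α) :
    ((List.finRange n).flatMap fun u => (List.finRange n).map fun v => F u v) =
      List.ofFn fun i : Fin (n * n) => F i.divNat i.modNat := by
  rw [List.ofFn_mul, List.flatMap_def, List.ofFn_eq_map]
  congr 1
  refine List.map_congr_left fun u _ => ?_
  rw [List.ofFn_eq_map]
  refine List.map_congr_left fun v _ => ?_
  have hn : 0 < n := v.pos
  congr 1 <;> ext
  · simp [Fin.divNat, Nat.add_div_of_dvd_right, Nat.mul_div_cancel _ hn, Nat.div_eq_of_lt v.isLt]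
  · simp [Fin.modNat, Nat.mod_eq_of_lt v.isLt]

namespace DSRInstance

variable (A : DSRInstance)

open Classical in
theorem encode_eq : A.encode = List.replicate A.n true ++ ([false] ++ (List.replicate A.k true ++
    ([false] ++ (List.ofFn (fun i : Fin (A.n * A.n) => decide (A.G.Adj i.divNat i.modNat)) ++
      (List.ofFn (fun v => decide (v ∈ A.init)) ++ List.ofFn fun v => decide (v ∈ A.fin)))))) := by
  rw [encode, flatMap_finRange_eq_ofFn, List.ofFn_eq_map (f := fun v => decide (v ∈ A.init)),
    List.ofFn_eq_map (f := fun v => decide (v ∈ A.fin))]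
  simp only [List.append_assoc]

theorem length_encode : A.n + A.k + 2 ≤ A.encode.length := by
  rw [encode_eq]
  simp only [List.length_append, List.length_replicate, List.length_singleton]
  omega

theorem inputSymbol_encode_n {i : ℕ} (hi : i < A.n) : inputSymbol A.encode i = 1 := by
  have h : A.encode[i]? = some true := by
    rw [encode_eq, List.getElem?_append_left (by simpa using hi)]
    simp [hi]
  rw [inputSymbol, h]

theorem inputSymbol_encode_n_end : inputSymbol A.encode A.n = 0 := by
  rw [encode_eq]
  exact inputSymbol_append (b := false) (by simp)

theorem inputSymbol_encode_k {i : ℕ} (hi : i < A.k) :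
    inputSymbol A.encode (A.n + 1 + i) = 1 := by
  have h : A.encode[A.n + 1 + i]? = some true := by
    rw [encode_eq, List.getElem?_append_right (by simp; omega),
      List.getElem?_append_right (by simp; omega)]
    have : A.n + 1 + i - (List.replicate A.n true).length - [false].length = i := by
      simp; omega
    rw [this, List.getElem?_append_left (by simpa using hi)]
    simp [hi]
  rw [inputSymbol, h]

theorem inputSymbol_encode_k_end : inputSymbol A.encode (A.n + 1 + A.k) = 0 := by
  rw [encode_eq, ← List.append_assoc, ← List.append_assoc]
  exact inputSymbol_append (b := false) (by simp; omega)

open Classical in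
theorem inputSymbol_encode_adj (u v : Fin A.n) :
    inputSymbol A.encode (A.n + A.k + 2 + (A.n * u + v)) = (decide (A.G.Adj u v)).toNat := by
  rw [encode_eq, ← List.append_assoc, ← List.append_assoc, ← List.append_assoc]
  have hn : 0 < A.n := v.pos
  have hlt : A.n * u + v < A.n * A.n := by
    have : A.n * (u + 1) ≤ A.n * A.n := Nat.mul_le_mul_left _ u.isLt
    have := v.isLt
    rw [Nat.mul_succ] at *
    omega
  have hd : (⟨A.n * u + v, hlt⟩ : Fin (A.n * A.n)).divNat = u := by
    ext
    simp [Fin.divNat, Nat.mul_add_div hn, Nat.div_eq_of_lt v.isLt]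
  have hm : (⟨A.n * u + v, hlt⟩ : Fin (A.n * A.n)).modNat = v := by
    ext
    simp [Fin.modNat, Nat.mod_eq_of_lt v.isLt]
  rw [inputSymbol_append_ofFn ⟨A.n * u + v, hlt⟩ (by simp; omega), hd, hm]

open Classical in
theorem inputSymbol_encode_init (v : Fin A.n) :
    inputSymbol A.encode (A.n + A.k + 2 + A.n * A.n + v) = (decide (v ∈ A.init)).toNat := by
  rw [encode_eq, ← List.append_assoc, ← List.append_assoc, ← List.append_assoc,
    ← List.append_assoc]
  exact inputSymbol_append_ofFn v (by simp; omega)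

open Classical in
theorem inputSymbol_encode_fin (v : Fin A.n) :
    inputSymbol A.encode (A.n + A.k + 2 + A.n * A.n + A.n + v) =
      (decide (v ∈ A.fin)).toNat := by
  rw [encode_eq, ← List.append_assoc, ← List.append_assoc, ← List.append_assoc,
    ← List.append_assoc, ← List.append_assoc,
    ← List.append_nil (List.ofFn fun v => decide (v ∈ A.fin))]
  exact inputSymbol_append_ofFn v (by simp; omega)

end DSRInstance

/-! ### Expressions for the bits of the new instance -/

namespace RegExpr

variable {m : ℕ} {x : List Bool} {ρ : Fin m → ℕ}

instance : Add (RegExpr m) := ⟨arith .add⟩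
instance : Sub (RegExpr m) := ⟨arith .sub⟩
instance : Mul (RegExpr m) := ⟨arith .mul⟩
instance : Div (RegExpr m) := ⟨arith .div⟩
instance : Mod (RegExpr m) := ⟨arith .mod⟩
instance (c : ℕ) : OfNat (RegExpr m) c := ⟨const c⟩

@[simp] theorem eval_add (a b : RegExpr m) : (a + b).eval x ρ = a.eval x ρ + b.eval x ρ := rfl
@[simp] theorem eval_sub (a b : RegExpr m) : (a - b).eval x ρ = a.eval x ρ - b.eval x ρ := rfl
@[simp] theorem eval_mul (a b : RegExpr m) : (a * b).eval x ρ = a.eval x ρ * b.eval x ρ := rfl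
@[simp] theorem eval_div (a b : RegExpr m) : (a / b).eval x ρ = a.eval x ρ / b.eval x ρ := rfl
@[simp] theorem eval_mod (a b : RegExpr m) : (a % b).eval x ρ = a.eval x ρ % b.eval x ρ := rfl
@[simp] theorem eval_zero : (0 : RegExpr m).eval x ρ = 0 := rfl
@[simp] theorem eval_one : (1 : RegExpr m).eval x ρ = 1 := rfl
@[simp] theorem eval_two : (2 : RegExpr m).eval x ρ = 2 := rfl
@[simp] theorem eval_read (a : RegExpr m) :
    (read a).eval x ρ = inputSymbol x (a.eval x ρ) := rfl
@[simp] theorem eval_ite (c a b : RegExpr m) :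
    (ite c a b).eval x ρ = if c.eval x ρ = 0 then b.eval x ρ else a.eval x ρ := by
  simp [eval]

/-- Nonzero if `a ≠ b`. -/
def ne (a b : RegExpr m) : RegExpr m := (a - b) + (b - a)

@[simp] theorem eval_ne (a b : RegExpr m) :
    (ne a b).eval x ρ = 0 ↔ a.eval x ρ = b.eval x ρ := by
  simp only [ne, eval_add, eval_sub]
  omega

/-- The number of vertices of the given instance. -/
def oldN : RegExpr 4 := var 0

/-- The number of tokens of the given instance. -/
def oldK : RegExpr 4 := var 1

/-- The number of vertices of the new instance. -/
def newN : RegExpr 4 := oldN + (oldN + (oldK + 1) * 2)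

/-- The adjacency of `u` and `v` in the given instance. -/
def oldAdj (u v : RegExpr 4) : RegExpr 4 := read (oldN + oldK + 2 + (oldN * u + v))

/-- The adjacency of `u` and `v` in the new instance. -/
def newAdj (u v : RegExpr 4) : RegExpr 4 :=
  ite (oldN - u)
    (ite (oldN - v) (ne u v)
      (ite (oldN + oldN - v) (ite (ne u (v - oldN)) (oldAdj u (v - oldN)) 1) 0))
    (ite (oldN + oldN - u)
      (ite (oldN - v) (ite (ne v (u - oldN)) (oldAdj (u - oldN) v) 1) 0)
      (ite (oldN + oldN - v) 0 (ite (ne u v) (ite (ne (u / 2) (v / 2)) 0 1) 0)))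

/-- Whether `v` is in the initial set of the new instance. -/
def newInit (v : RegExpr 4) : RegExpr 4 :=
  ite (oldN - v) (read (oldN + oldK + 2 + oldN * oldN + v)) (ite (oldN + oldN - v) 0 (1 - v % 2))

/-- Whether `v` is in the final set of the new instance. -/
def newFin (v : RegExpr 4) : RegExpr 4 :=
  ite (oldN - v) (read (oldN + oldK + 2 + oldN * oldN + oldN + v))
    (ite (oldN + oldN - v) 0 (v % 2))

end RegExpr

section eval

variable {A : DSRInstance} {a b : ℕ}

/-- The truncated differences `n - u` and `n + n - u` are nonzero exactly when `u` lies before the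
end of the first or second copy, so the nested conditionals reproduce the nine cases of
`slideGraph`. -/
theorem eval_newAdj {eu ev : RegExpr 4} {u v : Fin A.toSliding.n}
    (hu : eu.eval A.encode ![A.n, A.k, a, b] = u) (hv : ev.eval A.encode ![A.n, A.k, a, b] = v) :
    (RegExpr.newAdj eu ev).eval A.encode ![A.n, A.k, a, b] ≠ 0 ↔ A.toSliding.G.Adj u v := by
  obtain ⟨x, rfl⟩ := (slideEquiv A.n A.k).surjective u
  obtain ⟨y, rfl⟩ := (slideEquiv A.n A.k).surjective v
  have hG : A.toSliding.G.Adj (slideEquiv A.n A.k x) (slideEquiv A.n A.k y) ↔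
      (slideGraph A.G (Fin (A.k + 1))).Adj x y := by
    simp [DSRInstance.toSliding]
  have hn : RegExpr.oldN.eval A.encode ![A.n, A.k, a, b] = A.n := rfl
  have hk : RegExpr.oldK.eval A.encode ![A.n, A.k, a, b] = A.k := rfl
  refine Iff.trans ?_ hG.symm
  simp only [RegExpr.newAdj, RegExpr.eval_ite, RegExpr.eval_sub, RegExpr.eval_add, RegExpr.eval_ne,
    RegExpr.eval_div, RegExpr.eval_zero, RegExpr.eval_one, RegExpr.eval_two, RegExpr.oldAdj,
    RegExpr.eval_read, RegExpr.eval_mul,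
    hu, hv, hn, hk]
  rcases x with u | u | ⟨i, p⟩ <;> rcases y with v | v | ⟨j, q⟩ <;>
    simp only [slideEquiv_inl, slideEquiv_inr_inl, slideEquiv_inr_inr]
  · have hu' : A.n - (u : ℕ) ≠ 0 := by omega
    have hv' : A.n - (v : ℕ) ≠ 0 := by omega
    simp only [hu', hv', ↓reduceIte]
    rw [Ne, RegExpr.eval_ne, hu, hv, slideEquiv_inl, slideEquiv_inl,
      ← Fin.ext_iff]
    rfl
  · have hu' : A.n - (u : ℕ) ≠ 0 := by omega
    have hv' : A.n - (A.n + v) = 0 := by omega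
    have hv'' : A.n + A.n - (A.n + v) ≠ 0 := by omega
    simp only [hu', hv', hv'', Nat.add_sub_cancel_left, A.inputSymbol_encode_adj, ↓reduceIte]
    rcases eq_or_ne u v with rfl | h
    · simp [slideGraph]
    · have h₁ := Fin.val_ne_of_ne h
      by_cases hadj : A.G.Adj u v <;> simp [slideGraph, h, h₁, hadj]
  · have := u.isLt
    rw [if_neg (by omega), if_pos (by omega), if_pos (by omega)]
    simp [slideGraph]
  · have hu' : A.n - (A.n + u) = 0 := by omega
    have hu'' : A.n + A.n - (A.n + u) ≠ 0 := by omega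
    have hv' : A.n - (v : ℕ) ≠ 0 := by omega
    simp only [hu', hu'', hv', Nat.add_sub_cancel_left, A.inputSymbol_encode_adj, ↓reduceIte]
    rcases eq_or_ne u v with rfl | h
    · simp [slideGraph]
    · have h₁ := (Fin.val_ne_of_ne h).symm
      by_cases hadj : A.G.Adj u v <;> simp [slideGraph, h, h₁, hadj]
  · have hu' : A.n - (A.n + u) = 0 := by omega
    have hu'' : A.n + A.n - (A.n + u) ≠ 0 := by omega
    have hv' : A.n - (A.n + v) = 0 := by omega
    simp [hu', hu'', hv', slideGraph]
  · have := u.isLt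
    rw [if_pos (by omega), if_neg (by omega), if_pos (by omega)]
    simp [slideGraph]
  · have := v.isLt
    rw [if_pos (by omega), if_pos (by omega), if_neg (by omega)]
    simp [slideGraph]
  · have := v.isLt
    rw [if_pos (by omega), if_pos (by omega), if_neg (by omega)]
    simp [slideGraph]
  -- Two extra vertices are adjacent when their numbers differ but have equal halves.
  · rw [if_pos (by omega), if_pos (by omega), if_pos (by omega)]
    simp only [slideGraph, Fin.ext_iff]
    cases p <;> cases q <;> simp <;> omega

theorem eval_newInit {ev : RegExpr 4} {v : Fin A.toSliding.n}
    (hv : ev.eval A.encode ![A.n, A.k, a, b] = v) :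
    (RegExpr.newInit ev).eval A.encode ![A.n, A.k, a, b] ≠ 0 ↔ v ∈ A.toSliding.init := by
  obtain ⟨y, rfl⟩ := (slideEquiv A.n A.k).surjective v
  have hG : slideEquiv A.n A.k y ∈ A.toSliding.init ↔ y ∈ slideConfig A.init ∅ :=
    Finset.mem_map' (slideEquiv A.n A.k).toEmbedding
  have hn : RegExpr.oldN.eval A.encode ![A.n, A.k, a, b] = A.n := rfl
  have hk : RegExpr.oldK.eval A.encode ![A.n, A.k, a, b] = A.k := rfl
  refine Iff.trans ?_ hG.symm
  simp only [RegExpr.newInit, RegExpr.eval_ite, RegExpr.eval_sub, RegExpr.eval_add,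
    RegExpr.eval_mod, RegExpr.eval_zero, RegExpr.eval_one, RegExpr.eval_two, RegExpr.eval_read,
    RegExpr.eval_mul, hv, hn, hk]
  rcases y with v | v | ⟨j, q⟩
  · have := v.isLt
    rw [slideEquiv_inl, if_neg (by omega), A.inputSymbol_encode_init]
    simp
  · have := v.isLt
    rw [slideEquiv_inr_inl, if_pos (by omega), if_neg (by omega)]
    simp
  · rw [slideEquiv_inr_inr, if_pos (by omega), if_pos (by omega)]
    cases q <;> simp <;> omega

theorem eval_newFin {ev : RegExpr 4} {v : Fin A.toSliding.n}
    (hv : ev.eval A.encode ![A.n, A.k, a, b] = v) :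
    (RegExpr.newFin ev).eval A.encode ![A.n, A.k, a, b] ≠ 0 ↔ v ∈ A.toSliding.fin := by
  obtain ⟨y, rfl⟩ := (slideEquiv A.n A.k).surjective v
  have hG : slideEquiv A.n A.k y ∈ A.toSliding.fin ↔ y ∈ slideConfig A.fin Finset.univ :=
    Finset.mem_map' (slideEquiv A.n A.k).toEmbedding
  have hn : RegExpr.oldN.eval A.encode ![A.n, A.k, a, b] = A.n := rfl
  have hk : RegExpr.oldK.eval A.encode ![A.n, A.k, a, b] = A.k := rfl
  refine Iff.trans ?_ hG.symm
  simp only [RegExpr.newFin, RegExpr.eval_ite, RegExpr.eval_sub, RegExpr.eval_add,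
    RegExpr.eval_mod, RegExpr.eval_zero, RegExpr.eval_two, RegExpr.eval_read,
    RegExpr.eval_mul, hv, hn, hk]
  rcases y with v | v | ⟨j, q⟩
  · have := v.isLt
    rw [slideEquiv_inl, if_neg (by omega), A.inputSymbol_encode_fin]
    simp
  · have := v.isLt
    rw [slideEquiv_inr_inl, if_pos (by omega), if_neg (by omega)]
    simp
  · rw [slideEquiv_inr_inr, if_pos (by omega), if_pos (by omega)]
    cases q <;> simp <;> omega

end eval

/-! ### The machine -/

/-- Eight auxiliary registers suffice. -/
abbrev machineAux : ℕ := 8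

/-- Stores the number of vertices and the number of tokens in variables `0` and `1`. -/
def parseProgram : RegProg (4 + (machineAux + 1)) :=
  .seq (scanBlock 0 RegExpr.oldN) (scanBlock 1 (RegExpr.oldN + 1 + RegExpr.oldK))

/-- The position in the block that is being written. -/
def RegExpr.pos : RegExpr 4 := var 3

/-- The blocks of the encoding of the new instance: the length and the bits of every block. -/
def outputBlocks : List (RegExpr 4 × RegExpr 4) :=
  [(.newN, 1), (1, 0), (.oldK + (.oldK + 1), 1), (1, 0),
    (.newN * .newN, .newAdj (.pos / .newN) (.pos % .newN)),
    (.newN, .newInit .pos), (.newN, .newFin .pos)]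

/-- Writes a list of blocks. -/
def writeBlocks : List (RegExpr 4 × RegExpr 4) → RegProg (4 + (machineAux + 1))
  | [] => .skip
  | b :: l => .seq (writeBlock b.1 b.2) (writeBlocks l)

/-- The machine that computes the reduction. -/
def slidingProgram : RegProg (4 + (machineAux + 1)) := .seq parseProgram (writeBlocks outputBlocks)

/-- A bound on the weights of all expressions in the machine. -/
abbrev maxWeight : ℕ := 400

theorem weight_outputBlocks : ∀ b ∈ outputBlocks,
    b.1.depth ≤ machineAux ∧ b.2.depth ≤ machineAux ∧
      b.1.weight ≤ maxWeight ∧ b.2.weight ≤ maxWeight := by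
  intro b hb
  fin_cases hb <;> decide

theorem size_pow_le {X W : ℕ} (hX : 2 ≤ X) : (X ^ W).size ≤ W * (2 * Nat.log 2 X) + 1 := by
  rw [Nat.size_le]
  -- Doubling the logarithm absorbs the rounding, since it is at least `1`.
  have h : X ≤ 2 ^ (2 * Nat.log 2 X) := by
    refine (Nat.lt_pow_succ_log_self (by norm_num) X).le.trans
      (Nat.pow_le_pow_right (by norm_num) ?_)
    have : 1 ≤ Nat.log 2 X := Nat.log_pos (by norm_num) hX
    omega
  calc X ^ W ≤ (2 ^ (2 * Nat.log 2 X)) ^ W := Nat.pow_le_pow_left h W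
    _ = 2 ^ (W * (2 * Nat.log 2 X)) := by rw [← pow_mul, mul_comm]
    _ < _ := Nat.pow_lt_pow_right (by norm_num) (Nat.lt_succ_self _)

section machine

variable {x : List Bool} {N B sp n k : ℕ}

/-- The values left in variables `2` and `3` do not matter, since each block resets them; hence `c'`
and `d'` are merely asserted to exist. -/
theorem executes_writeBlocks (hN : 2 ≤ N) (hs : (4 + (machineAux + 1)) * B.size ≤ sp)
    (hB : N ^ maxWeight ≤ B) (hn : n ≤ N) (hk : k ≤ N) (l : List (RegExpr 4 × RegExpr 4))
    (hl : ∀ b ∈ l, b.1.depth ≤ machineAux ∧ b.2.depth ≤ machineAux ∧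
      b.1.weight ≤ maxWeight ∧ b.2.weight ≤ maxWeight) {L : List (List Bool)}
    (h : List.Forall₂ (fun b y => y.length ≤ N ∧
      (∀ j, b.1.eval x ![n, k, j, 0] = y.length) ∧
      ∀ j, ∀ i : Fin y.length, (b.2.eval x ![n, k, j, i] ≠ 0 ↔ y[i] = true)) l L)
    {c d : ℕ} (hc : c ≤ N) (hd : d ≤ N) (o : List Bool) :
    ∃ c' d', Executes x sp B (writeBlocks l) ![n, k, c, d] o ![n, k, c', d'] (o ++ L.flatten) := by
  have hpow : ∀ {a : ℕ}, a ≤ maxWeight → N ^ a ≤ B := fun h =>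
    (Nat.pow_le_pow_right (by omega) h).trans hB
  induction h generalizing c d o with
  | nil => exact ⟨c, d, fun e he => ⟨e, .skip e, by simpa using he⟩⟩
  | @cons b y l L hb _ ih =>
    obtain ⟨hy, hlen, hbit⟩ := hb
    obtain ⟨h₁, h₂, h₃, h₄⟩ := hl b (by simp)
    obtain ⟨c', d', hrest⟩ := ih (fun b' hb' => hl b' (by simp [hb'])) (Nat.zero_le N) hy (o ++ y)
    refine ⟨c', d', .seq ?_ (by simpa [List.append_assoc] using hrest)⟩
    have hfirst := Executes.writeBlock (x := x) (o := o) (s := machineAux) (bit := b.2)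
      (g := fun i => (y[i]?).getD false) hN hs hn hk hc hd hy (by norm_num) h₁ h₂
      (hpow (by norm_num)) (hpow h₃) (hpow h₄) (hlen c) (fun i hi j => by
        simpa [hi] using hbit j ⟨i, hi⟩)
    rw [map_range_eq_ofFn (f := fun i : Fin y.length => y[i]) (by simp)] at hfirst
    simpa using hfirst

/-- The count so far also gives the next position to read: `i` in the first scan, `n + 1 + i` in the
second, where the `1` skips the separator. -/
theorem executes_parseProgram (A : DSRInstance) (hN : 2 ≤ N)
    (hs : (4 + (machineAux + 1)) * B.size ≤ sp) (hB : N ^ maxWeight ≤ B) (hn : A.n ≤ N)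
    (hk : A.k ≤ N) :
    Executes A.encode sp B parseProgram ![0, 0, 0, 0] [] ![A.n, A.k, 0, 0] [] := by
  have hpow : ∀ {a : ℕ}, a ≤ maxWeight → N ^ a ≤ B := fun h =>
    (Nat.pow_le_pow_right (by omega) h).trans hB
  refine .seq (ρ₁ := ![A.n, 0, 0, 0])
    (Executes.scanBlock (f := fun i j => ![i, 0, j, 0]) (N := N) hN hs (by norm_num) (by decide)
      (hpow (by norm_num)) (hpow (by decide))
      (fun i hi j hj => vec_le (by omega) (by omega) (by omega) (by omega))
      (fun _ _ => rfl) (fun _ _ => rfl) (fun _ _ _ => update_vec_zero _)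
      (fun _ _ _ => update_vec_two _) (fun i hi j => A.inputSymbol_encode_n hi)
      (fun j => A.inputSymbol_encode_n_end))
    (Executes.scanBlock (f := fun i j => ![A.n, i, j, 0]) (N := N) hN hs (by norm_num)
      (by decide) (hpow (by norm_num)) (hpow (by decide))
      (fun i hi j hj => vec_le (by omega) (by omega) (by omega) (by omega))
      (fun _ _ => rfl) (fun _ _ => rfl) (fun _ _ _ => update_vec_one _)
      (fun _ _ _ => update_vec_two _) (fun i hi j => A.inputSymbol_encode_k hi)
      (fun j => A.inputSymbol_encode_k_end))

end machine

/-- The longest block is the new adjacency matrix, so `N` must bound the square of the new number of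
vertices. -/
theorem executes_slidingProgram (A : DSRInstance) {N B sp : ℕ} (hN : 2 ≤ N)
    (hs : (4 + (machineAux + 1)) * B.size ≤ sp) (hB : N ^ maxWeight ≤ B)
    (hNA : (A.n + (A.n + (A.k + 1) * 2)) * (A.n + (A.n + (A.k + 1) * 2)) ≤ N) :
    ∃ ρ, Executes A.encode sp B slidingProgram ![0, 0, 0, 0] [] ρ A.toSliding.encode := by
  classical
  have hN' : A.toSliding.n * A.toSliding.n ≤ N := hNA
  have hle : A.toSliding.n ≤ N := le_trans (Nat.le_mul_self _) hNA
  have hn : A.n ≤ N := le_trans (Nat.le_add_right _ _) hle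
  have hk' : A.toSliding.k ≤ A.toSliding.n := by
    change A.k + (A.k + 1) ≤ A.n + (A.n + (A.k + 1) * 2)
    omega
  have hk : A.k ≤ N := le_trans (Nat.le_add_right _ _) (hk'.trans hle)
  obtain ⟨c, d, h⟩ := executes_writeBlocks (x := A.encode) hN hs hB hn hk outputBlocks
    weight_outputBlocks (L := [List.replicate A.toSliding.n true, [false],
      List.replicate A.toSliding.k true, [false],
      List.ofFn (fun i : Fin (A.toSliding.n * A.toSliding.n) =>
        decide (A.toSliding.G.Adj i.divNat i.modNat)),
      List.ofFn (fun v => decide (v ∈ A.toSliding.init)),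
      List.ofFn fun v => decide (v ∈ A.toSliding.fin)]) (by
      refine .cons ?_ (.cons ?_ (.cons ?_ (.cons ?_ (.cons ?_ (.cons ?_ (.cons ?_ .nil))))))
      · refine ⟨by simpa using hle, fun j => ?_, fun j i => ?_⟩
        · rw [List.length_replicate]
          rfl
        · simp
      · refine ⟨by simpa using by omega, fun j => rfl, fun j i => ?_⟩
        simp
      · refine ⟨by simpa using hk'.trans hle, fun j => ?_, fun j i => ?_⟩
        · rw [List.length_replicate]
          rfl
        · simp
      · refine ⟨by simpa using by omega, fun j => rfl, fun j i => ?_⟩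
        simp
      · refine ⟨by simpa using hN', fun j => ?_, fun j i => ?_⟩
        · rw [List.length_ofFn]
          rfl
        · obtain ⟨i, hi⟩ := i
          rw [List.length_ofFn] at hi
          rw [eval_newAdj (u := Fin.divNat ⟨i, hi⟩) (v := Fin.modNat ⟨i, hi⟩)]
          · simp
          · rfl
          · rfl
      · refine ⟨by simpa using hle, fun j => ?_, fun j i => ?_⟩
        · rw [List.length_ofFn]
          rfl
        · obtain ⟨i, hi⟩ := i
          rw [List.length_ofFn] at hi
          rw [eval_newInit (v := ⟨i, hi⟩)]
          · simp
          · rfl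
      · refine ⟨by simpa using hle, fun j => ?_, fun j i => ?_⟩
        · rw [List.length_ofFn]
          rfl
        · obtain ⟨i, hi⟩ := i
          rw [List.length_ofFn] at hi
          rw [eval_newFin (v := ⟨i, hi⟩)]
          · simp
          · rfl) (Nat.zero_le N) (Nat.zero_le N) []
  refine ⟨![A.n, A.k, c, d], (executes_parseProgram A hN hs hB hn hk).seq ?_⟩
  rw [A.toSliding.encode_eq]
  simpa only [List.flatten_cons, List.flatten_nil, List.append_nil, List.nil_append] using h

theorem toSliding_logspace : ∃ (R : ℕ) (p : RegProg R) (h : ℕ → ℕ) (c : ℕ), Computable h ∧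
    ∀ A : DSRInstance, p.ComputesInSpace A.encode A.toSliding.encode
      (c * (h A.k + Nat.log 2 A.encode.length)) := by
  -- The space is logarithmic without any term in the parameter. The new graph has at most `X ^ 2`
  -- vertices, so `N = X ^ 4` works and values stay below `X ^ (4 * maxWeight)`. Then `size_pow_le`
  -- doubles the exponent, which gives the `8`, and its final `+ 1` is at most `Nat.log 2 X`. The
  -- first factor is the number of registers.
  refine ⟨_, slidingProgram, fun _ => 0, (4 + (machineAux + 1)) * (8 * maxWeight + 1),
    Computable.const 0, fun A => ?_⟩
  set X := A.encode.length with hX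
  have hlen : A.n + A.k + 2 ≤ X := A.length_encode
  have hN : 2 ≤ X ^ 4 := (by omega : 2 ≤ X).trans (Nat.le_self_pow (by norm_num) X)
  have hlog : 1 ≤ Nat.log 2 X := Nat.log_pos (by norm_num) (by omega)
  obtain ⟨ρ, h⟩ := executes_slidingProgram A (N := X ^ 4) (B := (X ^ 4) ^ maxWeight)
    (sp := (4 + (machineAux + 1)) * (8 * maxWeight + 1) * (0 + Nat.log 2 X)) hN (by
      rw [← pow_mul, mul_assoc]
      refine Nat.mul_le_mul_left _ ((size_pow_le (by omega)).trans ?_)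
      simp only [maxWeight]
      omega) le_rfl (by
      have h₁ : A.n + (A.n + (A.k + 1) * 2) ≤ X * X := by nlinarith
      calc _ ≤ (X * X) * (X * X) := Nat.mul_le_mul h₁ h₁
        _ = X ^ 4 := by ring)
  obtain ⟨d, hd, hdh⟩ := h (RegConfig.start _)
    ⟨fun i => by fin_cases i <;> rfl, rfl, fun _ => Nat.zero_le _⟩
  exact ⟨d, hd, hdh.out⟩

theorem isPLReduction_toSliding :
    IsPLReduction (DominatingSetReconfiguration .jumping) (DominatingSetReconfiguration .sliding)
      DSRInstance.toSliding where
  yes_iff A := by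
    constructor
    · rintro ⟨ℓ, h⟩
      exact ⟨_, h.toSliding⟩
    · rintro ⟨m, h⟩
      obtain ⟨ℓ, -, h⟩ := DSRInstance.HasSeq.of_toSliding h
      exact ⟨ℓ, h⟩
  param_le := ⟨fun k => k + (k + 1), (Primrec.nat_add.comp .id .succ).to_comp, fun _ => le_rfl⟩
  logspace := toSliding_logspace

theorem mainTheorem6 :
    ∃ f : DSRInstance → DSRInstance,
      IsPLReduction (DominatingSetReconfiguration .jumping)
        (DominatingSetReconfiguration .sliding) f ∧
      ∀ A : DSRInstance,
        (∀ ℓ : ℕ, A.HasSeqWithin .jumping ℓ ↔ (f A).HasSeqWithin .sliding (ℓ + A.k + 1)) ∧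
        (∀ ℓ : ℕ, A.HasSeq .jumping ℓ → (f A).HasSeq .sliding (ℓ + A.k + 1)) ∧
        (∀ m : ℕ, (f A).HasSeq .sliding m → ∃ ℓ : ℕ, ℓ + A.k + 1 ≤ m ∧ A.HasSeq .jumping ℓ) := by
  refine ⟨DSRInstance.toSliding, isPLReduction_toSliding, fun A =>
    ⟨fun ℓ => ⟨?_, ?_⟩, fun ℓ h => h.toSliding, fun m h => h.of_toSliding⟩⟩
  · rintro ⟨m, hm, h⟩
    exact ⟨m + A.k + 1, by omega, h.toSliding⟩
  · rintro ⟨m, hm, h⟩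
    obtain ⟨j, hj, h'⟩ := h.of_toSliding
    exact ⟨j, by omega, h'⟩
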